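/- Let $S$ be a transcendental semigroup, that is, the semigroup under composition generated by a non-empty (finite or infinite) collection of transcendental entire functions $\mathbb{C}\to\mathbb{C}$ (entire functions that are not polynomials). Call a set $G\subseteq\mathbb{C}$ completely invariant under $f$ if $f(G)\subseteq G$ and $f^{-1}(G)\subseteq G$. Let the completely invariant Julia set of $S$ be $$E(S)=\bigcap\{G\subseteq\mathbb{C} : G \text{ is closed, completely invariant under each } f\in S,\ \#(G)\ge 3\}.$$ If $E(S)$ has non-empty interior, then $E(S)=\mathbb{C}$. -/

import Mathlib

/-- A transcendental entire function: holomorphic on the whole plane and not a polynomial. -/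
def IsTranscendentalEntire (f : ℂ → ℂ) : Prop :=
  Differentiable ℂ f ∧ ¬ ∃ p : Polynomial ℂ, ∀ z : ℂ, f z = p.eval z

/-- A transcendental semigroup: the set of all finite compositions (of one or more factors) of
members of a non-empty, possibly infinite, collection of transcendental entire functions.
`Function.End ℂ` is the type `ℂ → ℂ` with composition as multiplication. -/
def IsTranscendentalSemigroup (S : Subsemigroup (Function.End ℂ)) : Prop :=
  ∃ F : Set (Function.End ℂ),
    F.Nonempty ∧ (∀ f ∈ F, IsTranscendentalEntire f) ∧ S = Subsemigroup.closure F

/-- Both forward invariant, `f(U) ⊆ U`, and backward invariant, `f⁻¹(U) ⊆ U`. -/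
def IsCompletelyInvariant {X : Type*} (f : X → X) (U : Set X) : Prop :=
  f '' U ⊆ U ∧ f ⁻¹' U ⊆ U

/-- The completely invariant Julia set `E(S)`: the intersection of all closed subsets of the plane
with at least three points that are completely invariant under every element of `S`. The bound on
the cardinality excludes the empty set and a common exceptional point of the elements of `S`. -/
def completelyInvariantJuliaSet (S : Subsemigroup (Function.End ℂ)) : Set ℂ :=
  ⋂₀ {G : Set ℂ | IsClosed G ∧ (∀ f ∈ S, IsCompletelyInvariant (X := ℂ) f G) ∧ 3 ≤ G.encard}

/-! Elements of `S` are continuous and open, so the boundary of `E(S)` is again closed and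
completely invariant. Were it infinite, minimality would put `E(S)` inside its own boundary, leaving
no interior. So it is finite, and `eq_univ_of_isClosed_of_finite_frontier` concludes. -/

theorem IsTranscendentalEntire.isOpenMap {f : ℂ → ℂ} (hf : IsTranscendentalEntire f) :
    IsOpenMap f := by
  have hA : AnalyticOnNhd ℂ f Set.univ := hf.1.differentiableOn.analyticOnNhd isOpen_univ
  rcases hA.is_constant_or_isOpen isPreconnected_univ with ⟨w, hw⟩ | h
  · exact absurd ⟨Polynomial.C w, fun z => by simp [hw z (Set.mem_univ z)]⟩ hf.2
  · exact fun s hs => h s (Set.subset_univ s) hs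

theorem IsTranscendentalSemigroup.continuous_isOpenMap {S : Subsemigroup (Function.End ℂ)}
    (hS : IsTranscendentalSemigroup S) {f : Function.End ℂ} (hf : f ∈ S) :
    Continuous (X := ℂ) (Y := ℂ) f ∧ IsOpenMap (X := ℂ) (Y := ℂ) f := by
  obtain ⟨F, -, hF, rfl⟩ := hS
  induction hf using Subsemigroup.closure_induction with
  | mem f hf => exact ⟨(hF f hf).1.continuous, (hF f hf).isOpenMap⟩
  | mul f g _ _ hf hg => exact ⟨hf.1.comp hg.1, hf.2.comp hg.2⟩

theorem isCompletelyInvariant_iff_preimage_eq {X : Type*} {f : X → X} {U : Set X} :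
    IsCompletelyInvariant f U ↔ f ⁻¹' U = U := by
  rw [IsCompletelyInvariant, Set.image_subset_iff, and_comm, Set.Subset.antisymm_iff]

/-- Complete invariance is `f ⁻¹' U = U`, and preimages under continuous open maps commute with
`frontier`. -/
theorem IsCompletelyInvariant.frontier {X : Type*} [TopologicalSpace X] {f : X → X} {U : Set X}
    (hc : Continuous f) (ho : IsOpenMap f) (h : IsCompletelyInvariant f U) :
    IsCompletelyInvariant f (frontier U) := by
  rw [isCompletelyInvariant_iff_preimage_eq] at h ⊢
  rw [ho.preimage_frontier_eq_frontier_preimage hc, h]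

theorem IsCompletelyInvariant.sInter {X : Type*} {f : X → X} {C : Set (Set X)}
    (h : ∀ U ∈ C, IsCompletelyInvariant f U) : IsCompletelyInvariant f (⋂₀ C) := by
  constructor
  · rintro _ ⟨x, hx, rfl⟩ U hU
    exact (h U hU).1 ⟨x, hx U hU, rfl⟩
  · exact fun x hx U hU => (h U hU).2 (hx U hU)

theorem isClosed_completelyInvariantJuliaSet (S : Subsemigroup (Function.End ℂ)) :
    IsClosed (completelyInvariantJuliaSet S) :=
  isClosed_sInter fun _ hG => hG.1

theorem isCompletelyInvariant_completelyInvariantJuliaSet {S : Subsemigroup (Function.End ℂ)}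
    {f : Function.End ℂ} (hf : f ∈ S) :
    IsCompletelyInvariant (X := ℂ) f (completelyInvariantJuliaSet S) :=
  IsCompletelyInvariant.sInter fun _ hG => hG.2.1 f hf

/-- A finite set does not separate the plane, so it cannot be the boundary between two non-empty
open sets. -/
theorem eq_univ_of_isClosed_of_finite_frontier {E : Set ℂ} (hE : IsClosed E)
    (hint : (interior E).Nonempty) (hfin : (frontier E).Finite) : E = Set.univ := by
  by_contra hne
  obtain ⟨y, hy⟩ := Set.nonempty_compl.2 hne
  obtain ⟨x, hx⟩ := hint
  have hconn : IsConnected (frontier E)ᶜ :=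
    hfin.countable.isConnected_compl_of_one_lt_rank (by rw [Complex.rank_real_complex]; norm_num)
  have hcover : (frontier E)ᶜ ⊆ interior E ∪ Eᶜ := fun z hz => by
    by_contra h
    rw [Set.mem_union, not_or] at h
    exact hz ⟨subset_closure (Set.not_notMem.1 h.2), h.1⟩
  -- Connectedness forces the disjoint sets `interior E` and `Eᶜ` to meet.
  obtain ⟨z, -, hz, hz'⟩ := hconn.isPreconnected _ _ isOpen_interior hE.isOpen_compl hcover
    ⟨x, fun h => h.2 hx, hx⟩ ⟨y, fun h => hy (hE.frontier_subset h), hy⟩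
  exact hz' (interior_subset hz)

theorem theorem1p3 (S : Subsemigroup (Function.End ℂ)) (hS : IsTranscendentalSemigroup S)
    (hE : (interior (completelyInvariantJuliaSet S)).Nonempty) :
    completelyInvariantJuliaSet S = Set.univ := by
  refine eq_univ_of_isClosed_of_finite_frontier (isClosed_completelyInvariantJuliaSet S) hE ?_
  by_contra hinf
  have hsub : completelyInvariantJuliaSet S ⊆ frontier (completelyInvariantJuliaSet S) := by
    refine Set.sInter_subset_of_mem ⟨isClosed_frontier, fun f hf => ?_, ?_⟩
    · obtain ⟨hc, ho⟩ := hS.continuous_isOpenMap hf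
      exact (isCompletelyInvariant_completelyInvariantJuliaSet hf).frontier hc ho
    · rw [Set.Infinite.encard_eq hinf]
      exact le_top
  obtain ⟨x, hx⟩ := hE
  exact (hsub (interior_subset hx)).2 hx
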